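/- Let $p$ be a prime and let $F$ be a perfect field of characteristic $p$. A restricted Lie algebra over $F$ is a Lie algebra $L$ over $F$ with a map $x\mapsto x^{[p]}$ such that $\operatorname{ad}(x^{[p]})=(\operatorname{ad}x)^p$, $(\alpha x)^{[p]}=\alpha^p x^{[p]}$ and $(x+y)^{[p]}=x^{[p]}+y^{[p]}+\sum_{i=1}^{p-1}s_i(x,y)$ for all $x,y\in L$ and $\alpha\in F$, where $i\,s_i(x,y)$ is the coefficient of $t^{i-1}$ in $(\operatorname{ad}(tx+y))^{p-1}(x)\in F[t]\otimes_F L$. Its restricted enveloping algebra $u(L)$ is the quotient of the universal enveloping algebra of $L$ by the two-sided ideal generated by all $x^p-x^{[p]}$, $x\in L$; and $L$ is called $p$-nilpotent if there is an $n$ such that the $n$-fold iterate of the map $x\mapsto x^{[p]}$ is zero on $L$. Let $L$ be a finite-dimensional, $p$-nilpotent, abelian restricted Lie algebra over $F$, and let $H$ be any restricted Lie algebra over $F$. If $u(L)\cong u(H)$ as associative $F$-algebras, then $L\cong H$ as restricted Lie algebras, that is, there is an isomorphism of Lie algebras $L\to H$ that commutes with the $p$-maps. -/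

import Mathlib

open scoped TensorProduct

noncomputable section

/-- The coefficient of `t ^ k` of an element of `F[t] ⊗ L`, that is, of a polynomial in `t` with
coefficients in `L`. -/
def polyLieCoeff (F : Type*) {L : Type*} [Field F] [LieRing L] [LieAlgebra F L] (k : ℕ) :
    Polynomial F ⊗[F] L →ₗ[F] L :=
  (TensorProduct.lid F L).toLinearMap ∘ₗ LinearMap.rTensor L (Polynomial.lcoeff F k)

/-- Jacobson's Lie polynomials `s_i(x, y)`: `i * s_i(x, y)` is the coefficient of `t ^ (i - 1)` in
`(ad (t x + y)) ^ (p - 1) (x)`, computed in the Lie algebra `F[t] ⊗ L` over `F[t]`.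
Used for `1 ≤ i ≤ p - 1` only. -/
def jacobsonS (F : Type*) (p : ℕ) {L : Type*} [Field F] [LieRing L] [LieAlgebra F L]
    (i : ℕ) (x y : L) : L :=
  (i : F)⁻¹ • polyLieCoeff F (i - 1)
    (((LieAlgebra.ad (Polynomial F) (Polynomial F ⊗[F] L)
        ((Polynomial.X : Polynomial F) ⊗ₜ[F] x + (1 : Polynomial F) ⊗ₜ[F] y)) ^ (p - 1))
      ((1 : Polynomial F) ⊗ₜ[F] x))

/-- A restricted Lie algebra over a field `F` of characteristic `p`: a Lie algebra together with
a `p`-map `x ↦ x^[p]`. -/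
class RestrictedLieAlgebra (F : Type*) (p : ℕ) (L : Type*) [Field F] [Fact p.Prime] [CharP F p]
    [LieRing L] [LieAlgebra F L] where
  /-- The `p`-map. -/
  pMap : L → L
  ad_pMap : ∀ x : L, LieAlgebra.ad F L (pMap x) = (LieAlgebra.ad F L x) ^ p
  pMap_smul : ∀ (a : F) (x : L), pMap (a • x) = a ^ p • pMap x
  pMap_add : ∀ x y : L,
    pMap (x + y) = pMap x + pMap y + ∑ i ∈ Finset.Icc 1 (p - 1), jacobsonS F p i x y

namespace RestrictedLieAlgebra

/-- The relations `x ^ p = x^[p]`, `x ∈ L`, imposed on the universal enveloping algebra of `L`. -/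
inductive EnvRel (F : Type*) (p : ℕ) (L : Type*) [Field F] [Fact p.Prime] [CharP F p]
    [LieRing L] [LieAlgebra F L] [RestrictedLieAlgebra F p L] :
    UniversalEnvelopingAlgebra F L → UniversalEnvelopingAlgebra F L → Prop
  | pow_p (x : L) : EnvRel F p L
      (UniversalEnvelopingAlgebra.ι F x ^ p)
      (UniversalEnvelopingAlgebra.ι F (pMap F p x))

/-- The restricted enveloping algebra `u(L)`: the quotient of the universal enveloping algebra by
the two-sided ideal generated by all `x ^ p - x^[p]`, `x ∈ L`. -/
abbrev RestrictedEnveloping (F : Type*) (p : ℕ) (L : Type*) [Field F] [Fact p.Prime] [CharP F p]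
    [LieRing L] [LieAlgebra F L] [RestrictedLieAlgebra F p L] :=
  RingQuot (EnvRel F p L)

/-- `L` is `p`-nilpotent: some iterate of the `p`-map vanishes on all of `L`. -/
def IsPNilpotent (F : Type*) (p : ℕ) (L : Type*) [Field F] [Fact p.Prime] [CharP F p]
    [LieRing L] [LieAlgebra F L] [RestrictedLieAlgebra F p L] : Prop :=
  ∃ n : ℕ, ∀ x : L, (pMap F p)^[n] x = 0

/-- An isomorphism of restricted Lie algebras: an isomorphism of Lie algebras that commutes with
the `p`-maps. -/
structure RestrictedLieEquiv (F : Type*) (p : ℕ) (L H : Type*) [Field F] [Fact p.Prime]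
    [CharP F p] [LieRing L] [LieAlgebra F L] [RestrictedLieAlgebra F p L]
    [LieRing H] [LieAlgebra F H] [RestrictedLieAlgebra F p H] extends L ≃ₗ⁅F⁆ H where
  map_pMap : ∀ x : L, toFun (pMap F p x) = pMap F p (toFun x)

end RestrictedLieAlgebra

end

/-! Commutativity of the enveloping algebra has to be turned into commutativity of $H$, and the
$p$-map has to be recovered from the algebra.

If $u(H)$ is commutative, its action on $H$ through `ad` gives class at most two. Write
$[x,y]=\beta(x,y)-\beta(y,x)$ with $\beta$ bilinear, central-valued and zero when an argument is
central. Then $\varphi(x)=x^{[p]}-\beta(x,x)$ is Frobenius-semilinear. On the commutative algebra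
$S$ generated by $H$ with relations $v^p=\varphi(v)$, let $x$ act as multiplication by $x$ plus the
derivation $v\mapsto\beta(x,v)$. This is a restricted representation in which $[x,y]$ acts as
multiplication by itself. Commutativity of $u(H)$ makes that zero, and $H$ embeds in $S$, so $H$ is
abelian (`isLieAbelian_of_env_comm`).

For abelian algebras the $p$-map $\varphi$ is itself semilinear. Truncated monomials in a basis are
independent in the envelope, so the subalgebra generated by all $p^k$-th powers has dimension
$p^{\dim\varphi^k(L)}$. Hence an isomorphism of envelopes preserves $\dim\varphi^k(L)$ for every $k$
(`finrank_iterateRange_eq`). Over a perfect field these ranks classify nilpotent semilinear maps, by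
induction on the image (`exists_intertwining_extend`). -/

/-! ### Normal forms modulo $X_i^p-\ell_i$ -/

namespace MvPolynomial

variable {I F : Type*} [Field F] {p : ℕ} (ℓ : I → MvPolynomial I F)

/-- A normal-form map for the rewriting $X_i^p\to\ell_i$, valid up to degree $d$. Each rewriting
lowers the degree, so the map in degree $d+1$ is built from the one in degree $d$. -/
theorem exists_partial_reduction (hℓ : ∀ i, (ℓ i).totalDegree < p) (d : ℕ) :
    ∃ N : MvPolynomial I F →ₗ[F] MvPolynomial I F,
      (∀ i q, q.totalDegree + p ≤ d → N (X i ^ p * q) = N (ℓ i * q)) ∧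
      ∀ m : I →₀ ℕ, (∀ i, m i < p) → N (monomial m 1) = monomial m 1 := by
  classical
  induction d with
  | zero =>
    refine ⟨LinearMap.id, fun i q h => ?_, fun _ _ => rfl⟩
    have := hℓ i
    omega
  | succ d ih =>
    obtain ⟨N, hN, hred⟩ := ih
    -- Only reducible monomials of top degree are new: rewrite one arbitrarily chosen $p$-th power,
    -- then apply the old map.
    let v : (I →₀ ℕ) → MvPolynomial I F := fun m =>
      if h : m.degree = d + 1 ∧ ∃ i, p ≤ m i then
        N (ℓ h.2.choose * monomial (m - Finsupp.single h.2.choose p) 1)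
      else N (monomial m 1)
    let N' : MvPolynomial I F →ₗ[F] MvPolynomial I F := (basisMonomials I F).constr F v
    have hN'v (m) : N' (monomial m 1) = v m := by
      have := (basisMonomials I F).constr_basis F v m
      simpa [N'] using this
    have hlow (f : MvPolynomial I F) (hf : f.totalDegree ≤ d) : N' f = N f := by
      rw [f.as_sum, map_sum, map_sum]
      refine Finset.sum_congr rfl fun m hm => ?_
      have hmd : m.degree ≤ d := (le_totalDegree hm).trans hf
      have : (monomial m (coeff m f) : MvPolynomial I F) = coeff m f • monomial m 1 := by
        simp [smul_monomial]
      rw [this, map_smul, map_smul, hN'v]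
      simp only [v]
      rw [dif_neg (by omega)]
    have hmon (i : I) (s : I →₀ ℕ) (hs : s.degree + p ≤ d + 1) :
        N' (X i ^ p * monomial s 1) = N' (ℓ i * monomial s 1) := by
      have hdeg (j : I) (t : I →₀ ℕ) :
          (ℓ j * monomial t 1).totalDegree < t.degree + p := by
        refine (totalDegree_mul _ _).trans_lt ?_
        have := hℓ j
        have h2 : (monomial t (1 : F)).totalDegree = t.degree :=
          totalDegree_monomial t one_ne_zero
        omega
      have hX (j : I) (t : I →₀ ℕ) :
          (X j ^ p * monomial t 1 : MvPolynomial I F) = monomial (Finsupp.single j p + t) 1 := by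
        rw [X_pow_eq_monomial, monomial_mul, one_mul]
      rw [hlow (ℓ i * monomial s 1) (by have := hdeg i s; omega)]
      rcases hs.lt_or_eq with hs' | hs'
      · rw [hlow, hN]
        · rw [totalDegree_monomial s one_ne_zero]
          change s.degree + p ≤ d
          omega
        · rw [hX, totalDegree_monomial _ one_ne_zero]
          change (Finsupp.single i p + s).degree ≤ d
          rw [map_add, Finsupp.degree_single]
          omega
      · have hm : (Finsupp.single i p + s).degree = d + 1 ∧
            ∃ j, p ≤ (Finsupp.single i p + s) j := by
          refine ⟨by rw [map_add, Finsupp.degree_single]; omega, i, by simp⟩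
        rw [hX, hN'v]
        simp only [v]
        rw [dif_pos hm]
        have hj := hm.2.choose_spec
        generalize hm.2.choose = j at hj ⊢
        -- The choice does not matter: for $j\ne i$ the monomial is divisible by $X_i^pX_j^p$, and
        -- both rewritings continue to $\ell_i\ell_j$ times the same cofactor.
        by_cases hij : j = i
        · rw [hij, add_tsub_cancel_left]
        · have hsj : p ≤ s j := by
            simpa [Finsupp.single_apply, Ne.symm hij] using hj
          obtain ⟨t, rfl⟩ : ∃ t, s = Finsupp.single j p + t := by
            refine ⟨s - Finsupp.single j p, (add_tsub_cancel_of_le ?_).symm⟩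
            rw [Finsupp.single_le_iff]
            exact hsj
          rw [add_left_comm, add_tsub_cancel_left, ← hX, ← hX, mul_left_comm,
            mul_left_comm (ℓ i)]
          rw [map_add, Finsupp.degree_single] at hs'
          have h1 := hdeg i t
          have h2 := hdeg j t
          rw [hN _ _ (by omega), hN _ _ (by omega), mul_left_comm]
    refine ⟨N', fun i q hq => ?_, fun m hm => ?_⟩
    · rw [q.as_sum, Finset.mul_sum, Finset.mul_sum, map_sum, map_sum]
      refine Finset.sum_congr rfl fun m hmq => ?_
      have hmd : m.degree ≤ q.totalDegree := le_totalDegree hmq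
      have : (monomial m (coeff m q) : MvPolynomial I F) = coeff m q • monomial m 1 := by
        simp [smul_monomial]
      rw [this, mul_smul_comm, mul_smul_comm, map_smul, map_smul, hmon _ _ (by omega)]
    · rw [hN'v]
      simp only [v]
      rw [dif_neg, hred m hm]
      rintro ⟨-, i, hi⟩
      exact absurd (hm i) (by omega)

/-- A polynomial of degree `< p` in each variable that lies in the ideal generated by
`X i ^ p - ℓ i`, where `ℓ i` has degree less than `p`, is zero. -/
theorem eq_zero_of_mem_span_of_reduced (hℓ : ∀ i, (ℓ i).totalDegree < p)
    {f : MvPolynomial I F} (hf : f ∈ Ideal.span (Set.range fun i => X i ^ p - ℓ i))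
    (hred : ∀ m ∈ f.support, ∀ i, m i < p) : f = 0 := by
  obtain ⟨c, rfl⟩ := Finsupp.mem_ideal_span_range_iff_exists_finsupp.1 hf
  obtain ⟨N, hN, hfix⟩ := exists_partial_reduction ℓ hℓ
    (c.support.sup (fun i => (c i).totalDegree) + p)
  set f := c.sum fun i a => a * (X i ^ p - ℓ i) with hfdef
  have h0 : N f = 0 := by
    rw [hfdef, Finsupp.sum, map_sum]
    refine Finset.sum_eq_zero fun i hi => ?_
    rw [mul_comm, sub_mul, map_sub, hN, sub_self]
    have := Finset.le_sup (f := fun i => (c i).totalDegree) hi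
    omega
  have h1 : N f = f := by
    conv_lhs => rw [f.as_sum]
    conv_rhs => rw [f.as_sum]
    rw [map_sum]
    refine Finset.sum_congr rfl fun m hm => ?_
    have : (monomial m (coeff m f) : MvPolynomial I F) = coeff m f • monomial m 1 := by
      simp [smul_monomial]
    rw [this, map_smul, hfix m (hred m hm)]
  rw [← h1, h0]

end MvPolynomial

theorem Commute.add_pow_char_of_algebra (F : Type*) {A : Type*} [Field F] (p : ℕ) [Fact p.Prime]
    [CharP F p] [Ring A] [Algebra F A] {x y : A} (h : Commute x y) :
    (x + y) ^ p = x ^ p + y ^ p := by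
  rcases subsingleton_or_nontrivial A with _ | _
  · exact Subsingleton.elim _ _
  · have : CharP A p := charP_of_injective_algebraMap (algebraMap F A).injective p
    exact add_pow_char_of_commute p h

/-! ### The restricted enveloping algebra -/

namespace RestrictedLieAlgebra

section Enveloping

attribute [local instance] LieRing.ofAssociativeRing

variable (F : Type*) (p : ℕ) {L : Type*} [Field F] [Fact p.Prime] [CharP F p]
  [LieRing L] [LieAlgebra F L] [RestrictedLieAlgebra F p L]

/-- The canonical map from a restricted Lie algebra to its restricted enveloping algebra. -/
noncomputable def envι : L →ₗ[F] RestrictedEnveloping F p L :=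
  (RingQuot.mkAlgHom F (EnvRel F p L)).toLinearMap ∘ₗ
    (UniversalEnvelopingAlgebra.ι F : L →ₗ⁅F⁆ UniversalEnvelopingAlgebra F L).toLinearMap

theorem envι_apply (x : L) :
    envι F p x = RingQuot.mkAlgHom F (EnvRel F p L) (UniversalEnvelopingAlgebra.ι F x) := rfl

theorem envι_lie (x y : L) :
    envι F p ⁅x, y⁆ = envι F p x * envι F p y - envι F p y * envι F p x := by
  rw [envι_apply, LieHom.map_lie, LieRing.of_associative_ring_bracket, map_sub, map_mul, map_mul]
  rfl

theorem envι_pow (x : L) : envι F p x ^ p = envι F p (pMap F p x) := by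
  rw [envι_apply, ← map_pow]
  exact RingQuot.mkAlgHom_rel F (EnvRel.pow_p x)

variable {A : Type*} [Ring A] [Algebra F A]

/-- The universal property of the restricted enveloping algebra. -/
theorem exists_envLift (f : L →ₗ[F] A) (hlie : ∀ x y, f ⁅x, y⁆ = f x * f y - f y * f x)
    (hpow : ∀ x, f x ^ p = f (pMap F p x)) :
    ∃ g : RestrictedEnveloping F p L →ₐ[F] A, ∀ x, g (envι F p x) = f x := by
  let f' : L →ₗ⁅F⁆ A := { f with map_lie' := fun {x y} => hlie x y }
  have hf' (x : L) : UniversalEnvelopingAlgebra.lift F f' (UniversalEnvelopingAlgebra.ι F x) = f x :=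
    UniversalEnvelopingAlgebra.lift_ι_apply F f' x
  refine ⟨RingQuot.liftAlgHom F ⟨UniversalEnvelopingAlgebra.lift F f', ?_⟩, fun x => ?_⟩
  · rintro _ _ ⟨x⟩
    rw [map_pow, hf', hf', hpow]
  · rw [envι_apply, RingQuot.liftAlgHom_mkAlgHom_apply, hf']

variable (L) in
theorem adjoin_range_envι : Algebra.adjoin F (Set.range (envι F p : L → _)) = ⊤ := by
  set S := Algebra.adjoin F (Set.range (envι F p : L → _))
  have hmem (x : L) : envι F p x ∈ S := Algebra.subset_adjoin ⟨x, rfl⟩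
  have key : (RingQuot.mkAlgHom F (EnvRel F p L)).range ≤ S := by
    rintro _ ⟨a, rfl⟩
    -- Lifting to $S$ and including back agrees with the quotient map on generators, hence
    -- everywhere, so the quotient map lands in $S$.
    let f : L →ₗ⁅F⁆ S :=
      { (envι F p).codRestrict S.toSubmodule hmem with
        map_lie' := fun {x y} => Subtype.ext (envι_lie F p x y) }
    have : S.val.comp (UniversalEnvelopingAlgebra.lift F f) = RingQuot.mkAlgHom F (EnvRel F p L) := by
      apply UniversalEnvelopingAlgebra.hom_ext
      ext x
      exact congrArg S.val (UniversalEnvelopingAlgebra.lift_ι_apply F f x)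
    change RingQuot.mkAlgHom F (EnvRel F p L) a ∈ S
    rw [← this]
    exact (UniversalEnvelopingAlgebra.lift F f a).2
  rw [eq_top_iff]
  intro a _
  obtain ⟨b, rfl⟩ := RingQuot.mkAlgHom_surjective F (EnvRel F p L) a
  exact key ⟨b, rfl⟩

theorem env_mul_comm [IsLieAbelian L] (a b : RestrictedEnveloping F p L) : a * b = b * a := by
  have h : ∀ a ∈ Set.range (envι F p : L → _), ∀ b ∈ Set.range (envι F p : L → _),
      a * b = b * a := by
    rintro _ ⟨x, rfl⟩ _ ⟨y, rfl⟩
    rw [← sub_eq_zero, ← envι_lie, trivial_lie_zero, map_zero]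
  have hc := Algebra.isMulCommutative_adjoin F h
  rw [adjoin_range_envι] at hc
  exact congrArg Subtype.val
    (hc.is_comm.comm (⟨a, trivial⟩ : (⊤ : Subalgebra F (RestrictedEnveloping F p L))) ⟨b, trivial⟩)

end Enveloping

end RestrictedLieAlgebra

/-! ### The commutative algebra with relations $v^p=\varphi(v)$ -/

section Model

open MvPolynomial

variable {F V I : Type*} [Field F] (p : ℕ) [Fact p.Prime] [CharP F p]
  [AddCommGroup V] [Module F V] (b : Module.Basis I F V) (φ : V →ₛₗ[frobenius F p] V)

/-- Linear polynomials attached to vectors by means of a basis. -/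
noncomputable def linForm : V →ₗ[F] MvPolynomial I F := b.constr F X

theorem linForm_basis (i : I) : linForm b (b i) = X i := b.constr_basis F _ i

theorem totalDegree_linForm_le (v : V) : (linForm b v).totalDegree ≤ 1 := by
  rw [linForm, Module.Basis.constr_apply]
  refine totalDegree_finsetSum_le fun i _ => (totalDegree_smul_le _ _).trans ?_
  rw [totalDegree_X]

/-- The ideal generated by the polynomials `X i ^ p - φ (b i)`. -/
noncomputable def truncIdeal : Ideal (MvPolynomial I F) :=
  Ideal.span (Set.range fun i => X i ^ p - linForm b (φ (b i)))

/-- The commutative algebra generated by `V` subject to the relations `v ^ p = φ v`. -/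
abbrev TruncAlgebra := MvPolynomial I F ⧸ truncIdeal p b φ

/-- The canonical map from `V` to the commutative algebra with relations `v ^ p = φ v`. -/
noncomputable def truncι : V →ₗ[F] TruncAlgebra p b φ :=
  (Ideal.Quotient.mkₐ F (truncIdeal p b φ)).toLinearMap ∘ₗ linForm b

theorem truncι_apply (v : V) :
    truncι p b φ v = Ideal.Quotient.mkₐ F (truncIdeal p b φ) (linForm b v) := rfl

theorem truncι_pow (v : V) : truncι p b φ v ^ p = truncι p b φ (φ v) := by
  induction b.mem_span v using Submodule.span_induction with
  | mem x hx =>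
    obtain ⟨i, rfl⟩ := hx
    rw [truncι_apply, truncι_apply, ← map_pow, ← sub_eq_zero, ← map_sub, linForm_basis]
    exact Ideal.Quotient.eq_zero_iff_mem.2 (Ideal.subset_span ⟨i, rfl⟩)
  | zero => simp [(Fact.out : p.Prime).ne_zero]
  | add x y _ _ hx hy =>
    rw [map_add, Commute.add_pow_char_of_algebra F p (Commute.all _ _), hx, hy, map_add, map_add]
  | smul a x _ hx =>
    rw [map_smul, smul_pow, hx, map_smulₛₗ, map_smul, frobenius_def]

theorem eq_zero_of_mk_eq_zero_of_reduced {f : MvPolynomial I F}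
    (hf : Ideal.Quotient.mkₐ F (truncIdeal p b φ) f = 0) (hred : ∀ m ∈ f.support, ∀ i, m i < p) :
    f = 0 :=
  eq_zero_of_mem_span_of_reduced _
    (fun _ => (totalDegree_linForm_le b _).trans_lt (Fact.out : p.Prime).one_lt)
    (Ideal.Quotient.eq_zero_iff_mem.1 hf) hred

theorem linForm_injective : Function.Injective (linForm b) := by
  classical
  intro v w h
  refine b.repr.injective (Finsupp.ext fun i => ?_)
  have key : lcoeff F (Finsupp.single i 1) ∘ₗ linForm b = b.coord i := by
    refine b.ext fun j => ?_
    simp [linForm_basis, coeff_X, Finsupp.single_apply, Finsupp.single_left_inj]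
  have := congrArg (lcoeff F (Finsupp.single i 1)) h
  rw [← LinearMap.comp_apply, ← LinearMap.comp_apply, key] at this
  exact this

theorem truncι_injective : Function.Injective (truncι p b φ) := by
  rw [← LinearMap.ker_eq_bot, LinearMap.ker_eq_bot']
  intro v hv
  refine (map_eq_zero_iff _ (linForm_injective b)).1
    -- Linear forms are reduced, because $1<p$.
    (eq_zero_of_mk_eq_zero_of_reduced p b φ hv fun m hm i => ?_)
  refine lt_of_le_of_lt ?_ (Fact.out : p.Prime).one_lt
  exact (Finsupp.le_degree i m).trans ((le_totalDegree hm).trans (totalDegree_linForm_le b v))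

variable {b} in
theorem adjoin_range_truncι : Algebra.adjoin F (Set.range (truncι p b φ)) = ⊤ := by
  rw [eq_top_iff]
  intro a _
  obtain ⟨f, rfl⟩ := Ideal.Quotient.mkₐ_surjective F (truncIdeal p b φ) a
  induction f using MvPolynomial.induction_on with
  | C r => exact Subalgebra.algebraMap_mem _ r
  | add f g hf hg => rw [map_add]; exact add_mem (hf trivial) (hg trivial)
  | mul_X f i hf =>
    rw [map_mul]
    refine mul_mem (hf trivial) (Algebra.subset_adjoin ⟨b i, ?_⟩)
    rw [truncι_apply, linForm_basis]

/-- A linear endomorphism of `V` vanishing on the image of `φ` extends to a derivation. -/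
theorem exists_truncDerivation (T : V →ₗ[F] V) (hT : ∀ v, T (φ v) = 0) :
    ∃ D : Derivation F (TruncAlgebra p b φ) (TruncAlgebra p b φ),
      ∀ v, D (truncι p b φ v) = truncι p b φ (T v) := by
  let d : Derivation F (MvPolynomial I F) (MvPolynomial I F) :=
    mkDerivation F fun i => linForm b (T (b i))
  have hd (v : V) : d (linForm b v) = linForm b (T v) := by
    have : (d : MvPolynomial I F →ₗ[F] MvPolynomial I F) ∘ₗ linForm b = linForm b ∘ₗ T := by
      refine b.ext fun i => ?_
      change d (linForm b (b i)) = _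
      rw [linForm_basis, mkDerivation_X]
      rfl
    exact LinearMap.congr_fun this v
  have hJ (f) (hf : Ideal.Quotient.mkₐ F (truncIdeal p b φ) f = 0) :
      Ideal.Quotient.mkₐ F (truncIdeal p b φ) (d f) = 0 := by
    induction Ideal.Quotient.eq_zero_iff_mem.1 hf using Submodule.span_induction with
    | mem x hx =>
      obtain ⟨i, rfl⟩ := hx
      have : d (X i ^ p - linForm b (φ (b i))) = 0 := by
        rw [map_sub, hd, hT, map_zero, Derivation.leibniz_pow, ← Nat.cast_smul_eq_nsmul F,
          CharP.cast_eq_zero, zero_smul, sub_zero]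
      rw [this, map_zero]
    | zero => simp
    | add x y hx hy h1 h2 =>
      rw [map_add, map_add, h1 (Ideal.Quotient.eq_zero_iff_mem.2 hx),
        h2 (Ideal.Quotient.eq_zero_iff_mem.2 hy), add_zero]
    | smul a x hx h1 =>
      have hx' : Ideal.Quotient.mkₐ F (truncIdeal p b φ) x = 0 :=
        Ideal.Quotient.eq_zero_iff_mem.2 hx
      rw [smul_eq_mul, Derivation.leibniz, map_add, smul_eq_mul, smul_eq_mul, map_mul, map_mul,
        h1 hx', hx', mul_zero, zero_mul, add_zero]
  refine ⟨Derivation.liftOfSurjective (Ideal.Quotient.mkₐ_surjective F (truncIdeal p b φ)) hJ,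
    fun v => ?_⟩
  rw [truncι_apply, Derivation.liftOfSurjective_apply, hd]
  rfl

end Model

/-! ### Powers of derivations in characteristic $p$ -/

section CharDerivation

variable {F A : Type*} [Field F] (p : ℕ) [Fact p.Prime] [CharP F p] [CommRing A] [Algebra F A]

/-- Multiplication intertwines $D\otimes1+1\otimes D$ with $D$. The two summands commute, so the
$p$-th power of the sum is $D^p\otimes1+1\otimes D^p$. -/
theorem Derivation.pow_char_leibniz (D : Derivation F A A) (a b : A) :
    ((D : A →ₗ[F] A) ^ p : Module.End F A) (a * b) =
      a * ((D : A →ₗ[F] A) ^ p : Module.End F A) b +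
        b * ((D : A →ₗ[F] A) ^ p : Module.End F A) a := by
  let d : Module.End F A := (D : A →ₗ[F] A)
  let l : Module.End F (A ⊗[F] A) := LinearMap.rTensor A d
  let r : Module.End F (A ⊗[F] A) := LinearMap.lTensor A d
  have hcomm : Commute l r := by
    change l * r = r * l
    refine TensorProduct.ext' fun x y => ?_
    simp [l, r]
  have hmul (n : ℕ) (t : A ⊗[F] A) :
      LinearMap.mul' F A (((l + r) ^ n) t) = (d ^ n) (LinearMap.mul' F A t) := by
    induction n generalizing t with
    | zero => simp
    | succ n ih =>
      rw [pow_succ, pow_succ, Module.End.mul_apply, Module.End.mul_apply, ih]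
      congr 1
      induction t using TensorProduct.induction_on with
      | zero => simp
      | add x y hx hy => simp only [map_add, hx, hy]
      | tmul x y =>
        simp [l, r, d, mul_comm y]
        ring
  have hl (n : ℕ) (x y : A) : (l ^ n) (x ⊗ₜ y) = (d ^ n) x ⊗ₜ y := by
    simp [l]
  have hr (n : ℕ) (x y : A) : (r ^ n) (x ⊗ₜ y) = x ⊗ₜ (d ^ n) y := by
    simp [r]
  have := hmul p (a ⊗ₜ b)
  rw [Commute.add_pow_char_of_algebra F p hcomm, LinearMap.add_apply, hl, hr, map_add,
    LinearMap.mul'_apply, LinearMap.mul'_apply, LinearMap.mul'_apply] at this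
  rw [← this, mul_comm b, add_comm]

theorem Derivation.pow_char_eq_zero (D : Derivation F A A) {s : Set A}
    (hs : Algebra.adjoin F s = ⊤) (h : ∀ a ∈ s, D (D a) = 0) :
    ((D : A →ₗ[F] A) ^ p : Module.End F A) = 0 := by
  let D' : Derivation F A A := Derivation.mk' ((D : A →ₗ[F] A) ^ p : Module.End F A)
    (D.pow_char_leibniz p)
  have : D' = 0 := by
    refine Derivation.ext_of_adjoin_eq_top s hs fun a ha => ?_
    obtain ⟨k, hk⟩ := Nat.exists_eq_add_of_le' (Fact.out : p.Prime).two_le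
    change ((D : A →ₗ[F] A) ^ p : Module.End F A) a = 0
    rw [hk, pow_add, Module.End.mul_apply, pow_two, Module.End.mul_apply]
    change ((D : A →ₗ[F] A) ^ k : Module.End F A) (D (D a)) = 0
    rw [h a ha, map_zero]
  ext a
  exact Derivation.congr_fun this a

end CharDerivation

/-! ### Splitting the bracket in class two -/

/-- In a Lie algebra of class at most two the bracket is the skew-symmetrization of a
bilinear map, which may be chosen alternating if `p` is odd. -/
theorem LieAlgebra.exists_bilin_of_class_two (F : Type*) (p : ℕ) (L : Type*) [Field F]
    [Fact p.Prime] [CharP F p] [LieRing L] [LieAlgebra F L]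
    (h2 : ∀ x y z : L, ⁅x, ⁅y, z⁆⁆ = 0) :
    ∃ β : L →ₗ[F] L →ₗ[F] L, (∀ x y, β x y - β y x = ⁅x, y⁆) ∧
      (∀ z : L, (∀ y : L, ⁅z, y⁆ = 0) → ∀ x, β x z = 0 ∧ β z x = 0) ∧
      (∀ x y z : L, ⁅β x y, z⁆ = 0) ∧ (p ≠ 2 → ∀ x, β x x = 0) := by
  classical
  have h2' (x y z : L) : ⁅⁅x, y⁆, z⁆ = 0 := by rw [← lie_skew, h2, neg_zero]
  by_cases hp : p = 2
  -- Halving is impossible for $p=2$: take instead the triangular half of the bracket in an ordered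
  -- basis of $L/Z$. Passing to the quotient by the centre makes $\beta$ vanish on central
  -- arguments.
  · let Z : Submodule F L := LinearMap.ker (LieAlgebra.ad F L : L →ₗ[F] Module.End F L)
    have hZ (z : L) : z ∈ Z ↔ ∀ y : L, ⁅z, y⁆ = 0 := by
      rw [LinearMap.mem_ker]
      constructor
      · intro h y
        exact LinearMap.congr_fun h y
      · intro h
        ext y
        exact h y
    obtain ⟨s, hs⟩ := Z.mkQ.exists_rightInverse_of_surjective Z.range_mkQ
    have hs' (v) : Z.mkQ (s v) = v := LinearMap.congr_fun hs v
    let b := Module.Basis.ofVectorSpace F (L ⧸ Z)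
    obtain ⟨_, -⟩ : ∃ _ : LinearOrder (Module.Basis.ofVectorSpaceIndex F (L ⧸ Z)), True :=
      ⟨linearOrderOfSTO WellOrderingRel, trivial⟩
    let β₀ : (L ⧸ Z) →ₗ[F] (L ⧸ Z) →ₗ[F] L :=
      b.constr F fun i => b.constr F fun j => if j < i then ⁅s (b i), s (b j)⁆ else 0
    have hβ₀ (i j) : β₀ (b i) (b j) = if j < i then ⁅s (b i), s (b j)⁆ else 0 := by
      simp only [β₀, Module.Basis.constr_basis]
    let br : L →ₗ[F] L →ₗ[F] L := (LieAlgebra.ad F L : L →ₗ[F] Module.End F L)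
    have key : β₀ - β₀.flip = br.compl₁₂ s s := by
      refine b.ext fun i => b.ext fun j => ?_
      change β₀ (b i) (b j) - β₀ (b j) (b i) = ⁅s (b i), s (b j)⁆
      rw [hβ₀, hβ₀]
      rcases lt_trichotomy i j with h | rfl | h
      · rw [if_neg h.not_gt, if_pos h, zero_sub, lie_skew]
      · simp
      · rw [if_pos h, if_neg h.not_gt, sub_zero]
    have hsec (x : L) : x - s (Z.mkQ x) ∈ Z := by
      refine (Submodule.Quotient.mk_eq_zero Z).1 ?_
      change Z.mkQ (x - s (Z.mkQ x)) = 0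
      rw [map_sub, hs', sub_self]
    have hcent (v w : L ⧸ Z) : β₀ v w ∈ Z := by
      have h0 : β₀.compr₂ Z.mkQ = 0 := by
        refine b.ext fun i => b.ext fun j => ?_
        change Z.mkQ (β₀ (b i) (b j)) = 0
        rw [hβ₀]
        split_ifs
        · exact (Submodule.Quotient.mk_eq_zero Z).2 ((hZ _).2 (h2' _ _))
        · exact map_zero _
      exact (Submodule.Quotient.mk_eq_zero Z).1 (LinearMap.congr_fun₂ h0 v w)
    refine ⟨β₀.compl₁₂ Z.mkQ Z.mkQ, fun x y => ?_, fun z hz x => ?_, fun x y => ?_,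
      fun h => absurd hp h⟩
    · have h1 := LinearMap.congr_fun₂ key (Z.mkQ x) (Z.mkQ y)
      have h3 : ⁅x, y⁆ = ⁅s (Z.mkQ x), s (Z.mkQ y)⁆ := by
        have e1 := (hZ _).1 (hsec x) y
        have e2 := (hZ _).1 (hsec y) (s (Z.mkQ x))
        rw [sub_lie, sub_eq_zero] at e1 e2
        rw [e1, ← lie_skew, e2, lie_skew]
      rw [h3]
      exact h1
    · have : Z.mkQ z = 0 := (Submodule.Quotient.mk_eq_zero Z).2 ((hZ z).2 hz)
      simp only [LinearMap.compl₁₂_apply, this, map_zero, LinearMap.zero_apply, and_self]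
    · exact (hZ _).1 (hcent _ _)
  · have h2F : (2 : F) ≠ 0 := by
      intro h
      have := (CharP.cast_eq_zero_iff F p 2).1 (by exact_mod_cast h)
      exact hp ((Nat.prime_dvd_prime_iff_eq Fact.out Nat.prime_two).1 this)
    let br : L →ₗ[F] L →ₗ[F] L := (LieAlgebra.ad F L : L →ₗ[F] Module.End F L)
    have hbr (x y : L) : ((2 : F)⁻¹ • br) x y = (2 : F)⁻¹ • ⁅x, y⁆ := rfl
    refine ⟨(2 : F)⁻¹ • br, fun x y => ?_, fun z hz x => ?_, fun x y z => ?_, fun _ x => ?_⟩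
    · rw [hbr, hbr, ← lie_skew y x, ← smul_sub, sub_neg_eq_add, ← two_smul F,
        smul_smul, inv_mul_cancel₀ h2F, one_smul]
    · rw [hbr, hbr, hz, ← lie_skew x z, hz, neg_zero, smul_zero]
      exact ⟨rfl, rfl⟩
    · rw [hbr, smul_lie, h2', smul_zero]
    · rw [hbr, lie_self, smul_zero]

/-! ### A commutative envelope forces an abelian Lie algebra -/

namespace RestrictedLieAlgebra

variable {F : Type*} (p : ℕ) {L : Type*} [Field F] [Fact p.Prime] [CharP F p]
  [LieRing L] [LieAlgebra F L] [RestrictedLieAlgebra F p L]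

/-- Each $s_i$ comes from $p-1$ nested brackets, which vanish in class two once $p\ge3$. For $p=2$
only $s_1=[y,x]=[x,y]$ remains. -/
theorem pMap_add_of_class_two (h2 : ∀ x y z : L, ⁅x, ⁅y, z⁆⁆ = 0) (x y : L) :
    pMap F p (x + y) = pMap F p x + pMap F p y + if p = 2 then ⁅x, y⁆ else 0 := by
  rw [pMap_add]
  congr 1
  split_ifs with hp
  · subst hp
    have h0 : ⁅y, x⁆ = ⁅x, y⁆ := by
      rw [← lie_skew, neg_eq_iff_add_eq_zero, ← two_smul F, ← Nat.cast_two, CharP.cast_eq_zero,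
        zero_smul]
    simp [jacobsonS, polyLieCoeff, h0]
  · refine Finset.sum_eq_zero fun i _ => ?_
    have h3 : 3 ≤ p := lt_of_le_of_ne (Fact.out : p.Prime).two_le (Ne.symm hp)
    obtain ⟨k, hk⟩ : ∃ k, p - 1 = k + 2 := ⟨p - 3, by omega⟩
    rw [jacobsonS, hk, pow_add, Module.End.mul_apply, pow_two, Module.End.mul_apply]
    simp [h2]

/-- The modified `p`-map `x ↦ x^[p] - β x x`, which is semilinear. -/
def semilinearPMap (h2 : ∀ x y z : L, ⁅x, ⁅y, z⁆⁆ = 0) (β : L →ₗ[F] L →ₗ[F] L)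
    (hβ : ∀ x y, β x y - β y x = ⁅x, y⁆) (hodd : p ≠ 2 → ∀ x, β x x = 0) :
    L →ₛₗ[frobenius F p] L where
  toFun x := pMap F p x - β x x
  map_add' x y := by
    rw [pMap_add_of_class_two p h2]
    split_ifs with hp
    -- In characteristic 2 the polarization $\beta(x,y)+\beta(y,x)$ of $\beta(x,x)$ equals $[x,y]$,
    -- which cancels $s_1$.
    · subst hp
      have h0 : β y x + β y x = 0 := by
        rw [← two_smul F, ← Nat.cast_two, CharP.cast_eq_zero, zero_smul]
      rw [← hβ x y]
      simp only [map_add, LinearMap.add_apply]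
      rw [← sub_eq_zero]
      have : (pMap F 2 x + pMap F 2 y + (β x y - β y x) - (β x x + β y x + (β x y + β y y)) -
        (pMap F 2 x - β x x + (pMap F 2 y - β y y))) = -(β y x + β y x) := by abel
      rw [this, h0, neg_zero]
    · simp only [hodd hp]
      abel
  map_smul' a x := by
    rw [pMap_smul, map_smul, map_smul, LinearMap.smul_apply, smul_smul, frobenius_def]
    by_cases hp : p = 2
    · subst hp
      rw [smul_sub, pow_two]
    · rw [hodd hp, smul_zero, sub_zero, sub_zero]

/-- The adjoint representation is restricted, so it factors through the envelope; commutativity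
makes all $\operatorname{ad}y$, $\operatorname{ad}z$ commute. -/
theorem lie_lie_eq_zero_of_env_comm
    (hc : ∀ a b : RestrictedEnveloping F p L, a * b = b * a) (x y z : L) : ⁅x, ⁅y, z⁆⁆ = 0 := by
  obtain ⟨g, hg⟩ := exists_envLift F p (LieAlgebra.ad F L : L →ₗ[F] Module.End F L)
    (fun x y => by
      ext z
      simp)
    (fun x => (ad_pMap x).symm)
  have h := congrArg g (hc (envι F p y) (envι F p z))
  rw [map_mul, map_mul, hg, hg, ← sub_eq_zero] at h
  have h1 := LinearMap.congr_fun h x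
  rw [← lie_skew, neg_eq_zero, lie_lie]
  exact h1

theorem lie_pMap_eq_zero (h2 : ∀ x y z : L, ⁅x, ⁅y, z⁆⁆ = 0) (x y : L) :
    ⁅pMap F p x, y⁆ = 0 := by
  obtain ⟨k, hk⟩ := Nat.exists_eq_add_of_le' (Fact.out : p.Prime).two_le
  have := LinearMap.congr_fun (ad_pMap (F := F) (p := p) x) y
  rw [LieAlgebra.ad_apply] at this
  rw [this, hk, pow_add, Module.End.mul_apply, pow_two, Module.End.mul_apply,
    LieAlgebra.ad_apply, LieAlgebra.ad_apply, h2, map_zero]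

/-- Multiplication by `j x` plus the derivation `D x` defines a restricted representation of `L`
on `S`. If the restricted enveloping algebra is commutative, brackets act by zero. -/
theorem map_lie_eq_zero_of_env_comm {S : Type*} [CommRing S] [Algebra F S]
    (h2 : ∀ x y z : L, ⁅x, ⁅y, z⁆⁆ = 0) {β : L →ₗ[F] L →ₗ[F] L}
    (hβ : ∀ x y, β x y - β y x = ⁅x, y⁆)
    (hβZ : ∀ z : L, (∀ y : L, ⁅z, y⁆ = 0) → ∀ x, β x z = 0 ∧ β z x = 0)
    (hβc : ∀ x y z : L, ⁅β x y, z⁆ = 0) (hodd : p ≠ 2 → ∀ x, β x x = 0)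
    {j : L →ₗ[F] S} (hj : Algebra.adjoin F (Set.range j) = ⊤)
    (hjp : ∀ x, j x ^ p = j (pMap F p x) - j (β x x))
    {D : L → Derivation F S S} (hD' : ∀ x v, D x (j v) = j (β x v))
    (hc : ∀ a b : RestrictedEnveloping F p L, a * b = b * a) (x y : L) : j ⁅x, y⁆ = 0 := by
  have h2' (x y z : L) : ⁅⁅x, y⁆, z⁆ = 0 := by rw [← lie_skew, h2, neg_zero]
  have hpZ := lie_pMap_eq_zero (F := F) p h2
  have hDext (D₁ D₂ : Derivation F (S) (S))
      (h : ∀ v, D₁ (j v) = D₂ (j v)) : D₁ = D₂ := by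
    refine Derivation.ext_of_adjoin_eq_top _ hj ?_
    rintro _ ⟨v, rfl⟩
    exact h v
  -- Hence central elements, in particular brackets and $p$-th powers, act by multiplication alone.
  have hDZ (z : L) (hz : ∀ y : L, ⁅z, y⁆ = 0) : D z = 0 :=
    hDext _ _ fun v => by rw [hD', (hβZ z hz v).2, map_zero, Derivation.zero_apply]
  let E : L →ₗ[F] Module.End F (S) :=
    { toFun := fun x => LinearMap.mulLeft F (j x) + (D x : _ →ₗ[F] _)
      map_add' := fun x y => by
        have : D (x + y) = D x + D y := hDext _ _ fun v => by
          rw [Derivation.add_apply, hD', hD', hD', map_add, LinearMap.add_apply, map_add]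
        ext a
        simp [this, add_mul]
        abel
      map_smul' := fun r x => by
        have : D (r • x) = r • D x := hDext _ _ fun v => by
          rw [Derivation.smul_apply, hD', hD', map_smul, LinearMap.smul_apply, map_smul]
        ext a
        simp [this] }
  have hE (x a) : E x a = j x * a + D x a := rfl
  have hEZ (z : L) (hz : ∀ y : L, ⁅z, y⁆ = 0) : E z = LinearMap.mulLeft F (j z) := by
    ext a
    simp [hE, hDZ z hz]
  have hDD (x y a) : D x (D y a) = D y (D x a) := by
    have : ⁅D x, D y⁆ = 0 := hDext _ _ fun v => by
      rw [Derivation.commutator_apply, hD', hD', hD', hD', (hβZ _ (hβc y v) x).1,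
        (hβZ _ (hβc x v) y).1, sub_self, Derivation.zero_apply]
    have h := Derivation.congr_fun this a
    rwa [Derivation.commutator_apply, Derivation.zero_apply, sub_eq_zero] at h
  obtain ⟨g, hg⟩ := exists_envLift F p E
    (fun x y => by
      rw [hEZ _ (h2' x y)]
      ext a
      simp only [LinearMap.mulLeft_apply, LinearMap.sub_apply, Module.End.mul_apply, hE, map_add,
        Derivation.leibniz, smul_eq_mul, hD', ← hβ x y, map_sub, hDD x y]
      ring)
    (fun x => by
      rw [hEZ _ (hpZ x)]
      have hDp : ((D x : _ →ₗ[F] _) ^ p : Module.End F (S)) = 0 := by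
        refine Derivation.pow_char_eq_zero p (D x) hj ?_
        rintro _ ⟨v, rfl⟩
        rw [hD', hD', (hβZ _ (hβc x v) x).1, map_zero]
      have hjp := hjp x
      -- For $p=2$, $(j(x)+D_x)^2=j(x)^2+j(\beta(x,x))$ since $D_x^2=0$ and the cross terms double.
      -- For odd $p$, $D_x$ kills $j(x)$, so the summands commute and their $p$-th powers add.
      by_cases hp : p = 2
      · subst hp
        ext a
        have ha : D x (D x a) = 0 := by
          rw [pow_two] at hDp
          exact LinearMap.congr_fun hDp a
        have h0 : j x * D x a + j x * D x a = 0 := by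
          rw [← two_smul F, ← Nat.cast_two, CharP.cast_eq_zero, zero_smul]
        rw [pow_two, Module.End.mul_apply, hE, hE, map_add, Derivation.leibniz, ha, hD',
          LinearMap.mulLeft_apply, smul_eq_mul, smul_eq_mul]
        have e : j (pMap F 2 x) = j x ^ 2 + j (β x x) := by rw [hjp, sub_add_cancel]
        rw [e]
        linear_combination h0
      · rw [hodd hp, map_zero, sub_zero] at hjp
        have hcm : Commute (LinearMap.mulLeft F (j x)) (D x : _ →ₗ[F] _) := by
          refine LinearMap.ext fun a => ?_
          change j x * D x a = D x (j x * a)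
          rw [Derivation.leibniz, hD', hodd hp, map_zero, smul_zero, add_zero, smul_eq_mul]
        change (LinearMap.mulLeft F (j x) + (D x : _ →ₗ[F] _) : Module.End F _) ^ p = _
        rw [Commute.add_pow_char_of_algebra F p hcm, hDp, add_zero, LinearMap.pow_mulLeft, hjp])
  have h := congrArg g (hc (envι F p x) (envι F p y))
  rw [← sub_eq_zero, ← map_sub, ← envι_lie, hg, hEZ _ (h2' x y)] at h
  have h1 := LinearMap.congr_fun h 1
  rwa [LinearMap.mulLeft_apply, mul_one, LinearMap.zero_apply] at h1

/-- A restricted Lie algebra with commutative restricted enveloping algebra is abelian. -/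
theorem isLieAbelian_of_env_comm
    (hc : ∀ a b : RestrictedEnveloping F p L, a * b = b * a) : IsLieAbelian L := by
  have h2 := lie_lie_eq_zero_of_env_comm p hc
  obtain ⟨β, hβ, hβZ, hβc, hodd⟩ := LieAlgebra.exists_bilin_of_class_two F p L h2
  let φ := semilinearPMap p h2 β hβ hodd
  have hφ (x : L) : φ x = pMap F p x - β x x := rfl
  let b := Module.Basis.ofVectorSpace F L
  -- The values of $\varphi$ are central, so $\beta(x,\cdot)$ kills them and respects the relations.
  have hex (x : L) := exists_truncDerivation p b φ (β x) fun v => by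
    rw [hφ, map_sub, (hβZ _ (lie_pMap_eq_zero p h2 v) x).1, (hβZ _ (hβc v v) x).1, sub_zero]
  choose D hD using hex
  refine ⟨fun x y => truncι_injective p b φ ?_⟩
  rw [map_zero]
  refine map_lie_eq_zero_of_env_comm p h2 hβ hβZ hβc hodd (adjoin_range_truncι p φ)
    (fun x => ?_) hD hc x y
  rw [truncι_pow, hφ, map_sub]

end RestrictedLieAlgebra

/-! ### Spanning by truncated monomials -/

section Span

variable {F A ι : Type*} [Field F] [CommRing A] [Algebra F A] [Fintype ι] {p : ℕ}

/-- If the `p`-th power of each `x i` is a linear combination of the `x j`, then the subalgebra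
generated by the `x i` is spanned by the monomials of degree `< p` in each variable. -/
theorem adjoin_range_eq_span_truncated_monomials (hp : 1 < p) {x : ι → A}
    (hx : ∀ i, x i ^ p ∈ Submodule.span F (Set.range x)) :
    Subalgebra.toSubmodule (Algebra.adjoin F (Set.range x)) =
      Submodule.span F (Set.range fun e : ι → Fin p => ∏ i, x i ^ (e i : ℕ)) := by
  classical
  set M := Submodule.span F (Set.range fun e : ι → Fin p => ∏ i, x i ^ (e i : ℕ))
  have key (n : ℕ) : ∀ m : ι → ℕ, ∑ i, m i = n → ∏ i, x i ^ m i ∈ M := by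
    induction n using Nat.strong_induction_on with
    | _ n ih =>
      intro m hm
      by_cases hred : ∀ i, m i < p
      · exact Submodule.subset_span ⟨fun i => ⟨m i, hred i⟩, rfl⟩
      · push Not at hred
        obtain ⟨i, hi⟩ := hred
        obtain ⟨m', rfl⟩ : ∃ m' : ι → ℕ, m = m' + Pi.single i p := by
          refine ⟨m - Pi.single i p, (tsub_add_cancel_of_le ?_).symm⟩
          intro k
          by_cases hk : k = i
          · subst hk; simpa using hi
          · simp [hk]
        have hprod (k : ι) (q : ℕ) :
            ∏ l, x l ^ (m' + Pi.single k q : ι → ℕ) l = (∏ l, x l ^ m' l) * x k ^ q := by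
          simp only [Pi.add_apply, pow_add, Finset.prod_mul_distrib]
          congr 1
          rw [Finset.prod_eq_single k] <;> simp +contextual
        have hsum (k : ι) (q : ℕ) : ∑ l, (m' + Pi.single k q : ι → ℕ) l = ∑ l, m' l + q := by
          simp [Finset.sum_add_distrib]
        rw [hprod]
        rw [hsum] at hm
        have hxi := hx i
        generalize x i ^ p = y at hxi
        induction hxi using Submodule.span_induction with
        | mem y hy =>
          obtain ⟨k, rfl⟩ := hy
          -- Replacing $x_i^p$ by some $x_k$ lowers the degree by $p-1>0$.
          have := ih (∑ l, m' l + 1) (by omega) (m' + Pi.single k 1) (hsum k 1)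
          rwa [hprod, pow_one] at this
        | zero => simp
        | add y z _ _ hy hz => rw [mul_add]; exact add_mem hy hz
        | smul a y _ hy => rw [mul_smul_comm]; exact M.smul_mem a hy
  apply le_antisymm
  · intro a ha
    rw [Algebra.adjoin_range_eq_range_aeval] at ha
    obtain ⟨f, rfl⟩ := ha
    change MvPolynomial.aeval x f ∈ M
    rw [MvPolynomial.aeval_def, MvPolynomial.eval₂_eq']
    refine sum_mem fun m _ => ?_
    rw [← Algebra.smul_def]
    exact M.smul_mem _ (key _ m rfl)
  · rw [Submodule.span_le]
    rintro _ ⟨e, rfl⟩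
    have hmem (i) : x i ∈ Algebra.adjoin F (Set.range x) := Algebra.subset_adjoin ⟨i, rfl⟩
    exact (Algebra.adjoin F (Set.range x)).prod_mem fun i _ => pow_mem (hmem i) _

end Span

/-! ### Ranks of the iterates as invariants of the algebra -/

section Dimension

open MvPolynomial Module

variable {F V : Type*} [Field F] {p : ℕ} [Fact p.Prime] [CharP F p]
  [AddCommGroup V] [Module F V] {φ : V →ₛₗ[frobenius F p] V}

theorem linearIndependent_truncated_monomials {ι I : Type*} [Fintype ι] (b : Basis I F V)
    {k : ι → I} (hk : Function.Injective k) :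
    LinearIndependent F fun e : ι → Fin p => ∏ i, truncι p b φ (b (k i)) ^ (e i : ℕ) := by
  classical
  let m (e : ι → Fin p) : I →₀ ℕ := ∑ i, Finsupp.single (k i) (e i : ℕ)
  have hmk (e : ι → Fin p) (i : ι) : m e (k i) = e i := by
    simp [m, Finsupp.finsetSum_apply, Finsupp.single_apply, hk.eq_iff]
  have hm : Function.Injective m := fun e e' h => by
    funext i
    apply Fin.ext
    rw [← hmk, ← hmk, h]
  have hmlt (e : ι → Fin p) (l : I) : m e l < p := by
    by_cases hl : ∃ i, k i = l
    · obtain ⟨i, rfl⟩ := hl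
      rw [hmk]
      exact (e i).2
    · push Not at hl
      have : m e l = 0 := by simp [m, Finsupp.finsetSum_apply, hl]
      rw [this]
      exact (Fact.out : p.Prime).pos
  have hprod (e : ι → Fin p) : ∏ i, truncι p b φ (b (k i)) ^ (e i : ℕ) =
      Ideal.Quotient.mkₐ F (truncIdeal p b φ) (monomial (m e) 1) := by
    simp only [truncι_apply, linForm_basis, ← map_pow, ← map_prod]
    congr 1
    simp only [X_pow_eq_monomial, m]
    rw [monomial_sum_one]
  simp only [hprod]
  have hli : LinearIndependent F fun e => (monomial (m e) 1 : MvPolynomial I F) := by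
    have := (basisMonomials I F).linearIndependent.comp m hm
    simpa [Function.comp_def] using this
  refine hli.map (f := (Ideal.Quotient.mkₐ F (truncIdeal p b φ)).toLinearMap) ?_
  rw [Submodule.disjoint_def]
  intro f hf hf0
  refine eq_zero_of_mk_eq_zero_of_reduced p b φ hf0 ?_
  have : Submodule.span F (Set.range fun e => (monomial (m e) 1 : MvPolynomial I F)) ≤
      restrictSupport F {n | ∀ i, n i < p} := by
    rw [Submodule.span_le]
    rintro _ ⟨e, rfl⟩
    exact (monomial_mem_restrictSupport F).2 (Or.inl (hmlt e))
  intro n hn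
  exact (mem_restrictSupport_iff F).1 (this hf) hn

variable {A : Type*} [CommRing A] [Algebra F A] {j : V →ₗ[F] A}

variable (φ) in
/-- The commutative algebra `A` is generated by the image of `V` under `j`, with the defining
relations `j v ^ p = j (φ v)`. -/
structure IsTruncEnveloping (j : V →ₗ[F] A) : Prop where
  pow_eq : ∀ v, j v ^ p = j (φ v)
  adjoin_range : Algebra.adjoin F (Set.range j) = ⊤
  exists_lift : ∀ (s : Set V) (b : Basis s F V),
    ∃ g : A →ₐ[F] TruncAlgebra p b φ, ∀ v, g (j v) = truncι p b φ v

namespace IsTruncEnveloping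

theorem injective (h : IsTruncEnveloping φ j) : Function.Injective j := by
  obtain ⟨g, hg⟩ := h.exists_lift _ (Basis.ofVectorSpace F V)
  intro v w hvw
  apply truncι_injective p (Basis.ofVectorSpace F V) φ
  rw [← hg, ← hg, hvw]

theorem pow_pow_eq (h : IsTruncEnveloping φ j) (k : ℕ) (v : V) :
    j v ^ p ^ k = j (φ^[k] v) := by
  induction k with
  | zero => simp
  | succ k ih => rw [pow_succ, pow_mul, ih, h.pow_eq, Function.iterate_succ_apply']

theorem adjoin_image_eq_span (h : IsTruncEnveloping φ j) (W : Submodule F V)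
    (hW : ∀ w ∈ W, φ w ∈ W) {ι : Type*} [Fintype ι] (w : Basis ι F W) :
    Subalgebra.toSubmodule (Algebra.adjoin F (j '' W)) =
      Submodule.span F (Set.range fun e : ι → Fin p => ∏ i, j (w i) ^ (e i : ℕ)) := by
  have hspan : W.map j = Submodule.span F (Set.range fun i => j (w i)) := by
    have := congrArg (Submodule.map (j ∘ₗ W.subtype)) w.span_eq
    rw [Submodule.map_span, ← Set.range_comp, Submodule.map_top, LinearMap.range_comp,
      Submodule.range_subtype] at this
    exact this.symm
  have hadj : Algebra.adjoin F (j '' W) = Algebra.adjoin F (Set.range fun i => j (w i)) := by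
    have : (j '' W : Set A) = (W.map j : Submodule F A) := rfl
    rw [this, hspan, Algebra.adjoin_span]
  rw [hadj]
  refine adjoin_range_eq_span_truncated_monomials (Fact.out : p.Prime).one_lt fun i => ?_
  rw [h.pow_eq, ← hspan]
  exact Submodule.mem_map_of_mem (hW _ (w i).2)

/-- A basis of $W$ has $p^{\dim W}$ truncated monomials. They span since $W$ is $\varphi$-stable,
and are independent since the basis extends to one of $V$. -/
theorem finrank_adjoin_image (h : IsTruncEnveloping φ j) (W : Submodule F V)
    [FiniteDimensional F W] (hW : ∀ w ∈ W, φ w ∈ W) :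
    finrank F (Algebra.adjoin F (j '' W)) = p ^ finrank F W := by
  let w := finBasis F W
  have hli : LinearIndependent F fun i => (w i : V) :=
    w.linearIndependent.map' W.subtype W.ker_subtype
  have hs := hli.linearIndepOn_id
  let b := Basis.extend hs
  let k : Fin (finrank F W) → hs.extend (Set.subset_univ _) := fun i =>
    ⟨w i, hs.subset_extend _ ⟨i, rfl⟩⟩
  have hk : Function.Injective k := fun i i' hii => by
    have : (k i : V) = k i' := congrArg _ hii
    exact hli.injective this
  have hbk (i) : b (k i) = w i := Basis.extend_apply_self hs _
  obtain ⟨g, hg⟩ := h.exists_lift _ b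
  have hmon : LinearIndependent F
      fun e : Fin (finrank F W) → Fin p => ∏ i, j (w i) ^ (e i : ℕ) := by
    have := linearIndependent_truncated_monomials (p := p) (φ := φ) b hk
    refine LinearIndependent.of_comp g.toLinearMap ?_
    have heq : (g.toLinearMap ∘ fun e : Fin (finrank F W) → Fin p => ∏ i, j (w i) ^ (e i : ℕ)) =
        fun e => ∏ i, truncι p b φ (b (k i)) ^ (e i : ℕ) := by
      funext e
      simp [hbk, hg]
    rw [heq]
    exact this
  rw [← Subalgebra.finrank_toSubmodule, h.adjoin_image_eq_span W hW w, finrank_span_eq_card hmon]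
  simp

theorem finiteDimensional [FiniteDimensional F V] (h : IsTruncEnveloping φ j) :
    FiniteDimensional F A := by
  have := h.adjoin_image_eq_span ⊤ (fun _ _ => trivial) (finBasis F (⊤ : Submodule F V))
  rw [Submodule.top_coe, Set.image_univ, h.adjoin_range, Algebra.top_toSubmodule] at this
  exact ⟨this ▸ Submodule.fg_span (Set.finite_range _)⟩

end IsTruncEnveloping

instance RingHomSurjective.frobenius_of_perfect [PerfectRing F p] :
    RingHomSurjective (frobenius F p) :=
  ⟨surjective_frobenius F p⟩

variable [PerfectRing F p]

variable (φ) in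
/-- The image of the `k`-th iterate of a semilinear map. -/
def iterateRange (k : ℕ) : Submodule F V := (Submodule.map φ)^[k] ⊤

theorem mem_iterateRange {k : ℕ} {v : V} : v ∈ iterateRange φ k ↔ ∃ u, φ^[k] u = v := by
  induction k generalizing v with
  | zero => simp [iterateRange]
  | succ k ih =>
    rw [iterateRange, Function.iterate_succ_apply', Submodule.mem_map]
    constructor
    · rintro ⟨w, hw, rfl⟩
      obtain ⟨u, rfl⟩ := ih.1 hw
      exact ⟨u, Function.iterate_succ_apply' _ _ _⟩
    · rintro ⟨u, rfl⟩
      exact ⟨_, ih.2 ⟨u, rfl⟩, (Function.iterate_succ_apply' _ _ _).symm⟩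

theorem map_mem_iterateRange {k : ℕ} {v : V} (hv : v ∈ iterateRange φ k) :
    φ v ∈ iterateRange φ k := by
  obtain ⟨u, rfl⟩ := mem_iterateRange.1 hv
  exact mem_iterateRange.2
    ⟨φ u, by rw [← Function.iterate_succ_apply, Function.iterate_succ_apply']⟩

namespace IsTruncEnveloping

/-- The left side is intrinsic to the algebra, the right side sees $\varphi^k$; they agree because
$a\mapsto a^{p^k}$ is a ring homomorphism. -/
theorem adjoin_range_pow (h : IsTruncEnveloping φ j) (k : ℕ) :
    Algebra.adjoin F (Set.range fun a : A => a ^ p ^ k) =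
      Algebra.adjoin F (j '' iterateRange φ k) := by
  apply le_antisymm
  · refine Algebra.adjoin_le ?_
    rintro _ ⟨a, rfl⟩
    have ha : a ∈ Algebra.adjoin F (Set.range j) := h.adjoin_range ▸ trivial
    change a ^ p ^ k ∈ Algebra.adjoin F (j '' iterateRange φ k)
    induction ha using Algebra.adjoin_induction with
    | mem x hx =>
      obtain ⟨v, rfl⟩ := hx
      rw [h.pow_pow_eq]
      exact Algebra.subset_adjoin ⟨_, mem_iterateRange.2 ⟨v, rfl⟩, rfl⟩
    | algebraMap r => rw [← map_pow]; exact Subalgebra.algebraMap_mem _ _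
    | add x y _ _ hx hy =>
      have : (x + y) ^ p ^ k = x ^ p ^ k + y ^ p ^ k := by
        rcases subsingleton_or_nontrivial A with _ | _
        · exact Subsingleton.elim _ _
        · have : CharP A p := charP_of_injective_algebraMap (algebraMap F A).injective p
          exact add_pow_char_pow x y p k
      rw [this]
      exact add_mem hx hy
    | mul x y _ _ hx hy => rw [mul_pow]; exact mul_mem hx hy
  · refine Algebra.adjoin_mono ?_
    rintro _ ⟨v, hv, rfl⟩
    obtain ⟨u, rfl⟩ := mem_iterateRange.1 hv
    exact ⟨j u, h.pow_pow_eq k u⟩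

variable {V' A' : Type*} [AddCommGroup V'] [Module F V'] {φ' : V' →ₛₗ[frobenius F p] V'}
  [CommRing A'] [Algebra F A'] {j' : V' →ₗ[F] A'}

theorem finrank_iterateRange_eq [FiniteDimensional F V] [FiniteDimensional F V']
    (h : IsTruncEnveloping φ j) (h' : IsTruncEnveloping φ' j') (e : A ≃ₐ[F] A') (k : ℕ) :
    finrank F (iterateRange φ k) = finrank F (iterateRange φ' k) := by
  have h1 := h.finrank_adjoin_image (iterateRange φ k) fun _ => map_mem_iterateRange
  have h2 := h'.finrank_adjoin_image (iterateRange φ' k) fun _ => map_mem_iterateRange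
  rw [← adjoin_range_pow h] at h1
  rw [← adjoin_range_pow h'] at h2
  have himg : (Algebra.adjoin F (Set.range fun a : A => a ^ p ^ k)).map (e : A →ₐ[F] A') =
      Algebra.adjoin F (Set.range fun a : A' => a ^ p ^ k) := by
    rw [AlgHom.map_adjoin, ← Set.range_comp]
    congr 1
    ext a
    constructor
    · rintro ⟨b, rfl⟩
      exact ⟨e b, by simp⟩
    · rintro ⟨b, rfl⟩
      exact ⟨e.symm b, by simp⟩
  rw [← himg] at h2
  have h3 := (e.subalgebraMap
    (Algebra.adjoin F (Set.range fun a : A => a ^ p ^ k))).toLinearEquiv.finrank_eq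
  rw [h1] at h3
  exact Nat.pow_right_injective (Fact.out : p.Prime).two_le (h3.trans h2)

end IsTruncEnveloping

end Dimension

/-! ### Classification of nilpotent Frobenius-semilinear maps -/

section Classification

open Module

variable {F V V' : Type*} [Field F] [AddCommGroup V] [Module F V] [AddCommGroup V'] [Module F V']

theorem LinearMap.exists_equiv_extend_of_injective [FiniteDimensional F V]
    [FiniteDimensional F V'] (hfr : finrank F V = finrank F V') (P : Submodule F V)
    (f : P →ₗ[F] V') (hf : Function.Injective f) :
    ∃ g : V ≃ₗ[F] V', ∀ x : P, g x = f x := by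
  obtain ⟨C, hC⟩ := P.exists_isCompl
  obtain ⟨C', hC'⟩ := (LinearMap.range f).exists_isCompl
  have h1 := Submodule.finrank_add_eq_of_isCompl hC
  have h2 := Submodule.finrank_add_eq_of_isCompl hC'
  have h3 := LinearMap.finrank_range_of_inj hf
  let c : C ≃ₗ[F] C' := LinearEquiv.ofFinrankEq _ _ (by omega)
  refine ⟨(P.prodEquivOfIsCompl C hC).symm ≪≫ₗ ((LinearEquiv.ofInjective f hf).prodCongr c) ≪≫ₗ
    (LinearMap.range f).prodEquivOfIsCompl C' hC', fun x => ?_⟩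
  simp

variable {p : ℕ} [Fact p.Prime] [CharP F p] [PerfectRing F p]
  {φ : V →ₛₗ[frobenius F p] V} {φ' : V' →ₛₗ[frobenius F p] V'}

variable (φ) in
theorem finrank_ker_add_finrank_range_frobenius [FiniteDimensional F V] :
    finrank F (LinearMap.ker φ) + finrank F (LinearMap.range φ) = finrank F V := by
  obtain ⟨U, hU⟩ := (LinearMap.ker φ).exists_isCompl
  rw [← Submodule.finrank_add_eq_of_isCompl hU]
  congr 1
  let r : U →+ LinearMap.range φ :=
    { toFun := fun u => ⟨φ u, u, rfl⟩
      map_zero' := Subtype.ext (map_zero φ)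
      map_add' := fun u v => Subtype.ext (map_add φ (u : V) v) }
  have hr : Function.Bijective r := by
    constructor
    · rw [injective_iff_map_eq_zero]
      intro u hu
      exact Subtype.ext (Submodule.disjoint_def.1 hU.disjoint u
        (LinearMap.mem_ker.2 (congrArg Subtype.val hu)) u.2)
    · rintro ⟨_, v, rfl⟩
      obtain ⟨k, hk, u, hu, rfl⟩ := Submodule.mem_sup.1 (hU.sup_eq_top ▸ trivial :
        v ∈ LinearMap.ker φ ⊔ U)
      refine ⟨⟨u, hu⟩, Subtype.ext ?_⟩
      change φ u = φ (k + u)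
      rw [map_add, LinearMap.mem_ker.1 hk, zero_add]
  -- Perfectness makes Frobenius bijective on scalars, so a semilinear bijection preserves
  -- dimension.
  have := rank_eq_of_equiv_equiv (frobenius F p) (AddEquiv.ofBijective r hr)
    (bijective_frobenius F p) fun a u => Subtype.ext (map_smulₛₗ φ a (u : V))
  exact (congrArg Cardinal.toNat this).symm

/-- An isomorphism between the images of two semilinear maps that intertwines them extends to an
isomorphism of the whole spaces that intertwines them. -/
theorem exists_intertwining_extend [FiniteDimensional F V] [FiniteDimensional F V']
    (hfr : finrank F V = finrank F V') (ψ : LinearMap.range φ ≃ₗ[F] LinearMap.range φ')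
    (hψ : ∀ w : LinearMap.range φ, (ψ (φ.rangeRestrict w) : V') = φ' (ψ w)) :
    ∃ e : V ≃ₗ[F] V', ∀ v, e (φ v) = φ' (e v) := by
  let W := LinearMap.range φ
  let K := LinearMap.ker φ
  let K' := LinearMap.ker φ'
  -- Any linear lift of $\psi\varphi$ through $\varphi'$ may be changed by a map into
  -- $K'=\ker\varphi'$. The correction $\delta$ below makes it equal to $\psi$ on $W$ and to an
  -- isomorphism $g:K\to K'$ on $K$.
  obtain ⟨Ψ, hΨ⟩ : ∃ Ψ : V →ₗ[F] V', ∀ v, φ' (Ψ v) = ψ (φ.rangeRestrict v) := by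
    let b := Basis.ofVectorSpace F V
    have hex (i) : ∃ v', φ' v' = ψ (φ.rangeRestrict (b i)) := (ψ (φ.rangeRestrict (b i))).2
    choose c hc using hex
    refine ⟨b.constr F c, fun v => ?_⟩
    have : φ' ∘ₛₗ (b.constr F c : V →ₗ[F] V') =
        ((LinearMap.range φ').subtype ∘ₗ ψ.toLinearMap) ∘ₛₗ φ.rangeRestrict := by
      refine b.ext fun i => ?_
      change φ' (b.constr F c (b i)) = _
      rw [Basis.constr_basis, hc]
      rfl
    exact LinearMap.congr_fun this v
  have hK : finrank F K = finrank F K' := by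
    have h1 := finrank_ker_add_finrank_range_frobenius φ
    have h2 := finrank_ker_add_finrank_range_frobenius φ'
    have h3 := ψ.finrank_eq
    change finrank F (LinearMap.ker φ) = finrank F (LinearMap.ker φ')
    omega
  have hψK (w : W) (hw : (w : V) ∈ K) : (ψ w : V') ∈ K' := by
    have h0 : φ.rangeRestrict w = 0 := Subtype.ext hw
    rw [LinearMap.mem_ker, ← hψ, h0, map_zero]
    rfl
  let P : Submodule F K := W.comap K.subtype
  let i : P →ₗ[F] W := (K.subtype ∘ₗ P.subtype).codRestrict W fun x => x.2
  let f : P →ₗ[F] K' := LinearMap.codRestrict K'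
    ((LinearMap.range φ').subtype ∘ₗ ψ.toLinearMap ∘ₗ i) fun x => hψK (i x) x.1.2
  have hf : Function.Injective f := by
    intro x y hxy
    have h1 : (ψ (i x) : V') = ψ (i y) := congrArg K'.subtype hxy
    have h2 : (x : V) = y := congrArg W.subtype (ψ.injective (Subtype.ext h1))
    exact Subtype.ext (Subtype.ext h2)
  -- Since $g$ extends $\psi$ on $W\cap K$, the two prescriptions for $\delta$ agree there and glue.
  obtain ⟨g, hg⟩ := LinearMap.exists_equiv_extend_of_injective hK P f hf
  let δW : W →ₗ[F] K' := LinearMap.codRestrict K'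
    ((LinearMap.range φ').subtype ∘ₗ ψ.toLinearMap - Ψ ∘ₗ W.subtype) fun w => by
      change φ' ((ψ w : V') - Ψ w) = 0
      rw [map_sub, hΨ, hψ, sub_self]
  let δK : K →ₗ[F] K' := g.toLinearMap - LinearMap.codRestrict K' (Ψ ∘ₗ K.subtype) fun k => by
    change φ' (Ψ k) = 0
    have h0 : φ.rangeRestrict (k : V) = 0 := Subtype.ext k.2
    rw [hΨ, h0, map_zero]
    rfl
  have hagree (x : W) (y : K) (hxy : (x : V) = y) : δW x = δK y := by
    have hy : (y : V) ∈ W := hxy ▸ x.2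
    have h1 := congrArg Subtype.val (hg ⟨y, hy⟩)
    have h2 : x = ⟨y, hy⟩ := Subtype.ext hxy
    apply Subtype.ext
    change (ψ x : V') - Ψ x = (g y : V') - Ψ y
    rw [hxy, h1, h2]
    rfl
  let dW : V →ₗ.[F] K' := ⟨W, δW⟩
  let dK : V →ₗ.[F] K' := ⟨K, δK⟩
  obtain ⟨δ, hδ⟩ := LinearMap.exists_extend (dW.sup dK hagree).toFun
  have hδW (w : W) : δ w = δW w := by
    have hle := LinearPMap.left_le_sup dW dK hagree
    exact (LinearMap.congr_fun hδ ⟨w, hle.1 w.2⟩).trans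
      (hle.2 (x := w) (y := ⟨w, hle.1 w.2⟩) rfl).symm
  have hδK (k : K) : δ k = δK k := by
    have hle := LinearPMap.right_le_sup dW dK hagree
    exact (LinearMap.congr_fun hδ ⟨k, hle.1 k.2⟩).trans
      (hle.2 (x := k) (y := ⟨k, hle.1 k.2⟩) rfl).symm
  let Θ : V →ₗ[F] V' := Ψ + K'.subtype ∘ₗ δ
  have hΘ (v : V) : φ' (Θ v) = ψ (φ.rangeRestrict v) := by
    change φ' (Ψ v + δ v) = _
    rw [map_add, hΨ, LinearMap.mem_ker.1 (δ v).2, add_zero]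
  have hΘW (w : W) : Θ w = ψ w := by
    change Ψ w + (δ w : V') = _
    rw [hδW]
    change Ψ w + ((ψ w : V') - Ψ w) = _
    rw [add_sub_cancel]
  have hΘK (k : K) : Θ k = g k := by
    change Ψ k + (δ k : V') = _
    rw [hδK]
    change Ψ k + ((g k : V') - Ψ k) = _
    rw [add_sub_cancel]
  -- If $\Theta v=0$ then $\psi(\varphi v)=0$, so $v\in K$, where $\Theta$ is the injective $g$.
  have hinj : Function.Injective Θ := by
    rw [injective_iff_map_eq_zero]
    intro v hv
    have h1 := hΘ v
    rw [hv, map_zero] at h1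
    have h2 : φ.rangeRestrict v = 0 := ψ.map_eq_zero_iff.1 (Subtype.ext h1.symm)
    have hvK : v ∈ K := congrArg Subtype.val h2
    have h3 := hΘK ⟨v, hvK⟩
    change Θ v = _ at h3
    rw [hv] at h3
    have h4 : (⟨v, hvK⟩ : K) = 0 := g.map_eq_zero_iff.1 (Subtype.ext h3.symm)
    exact congrArg Subtype.val h4
  refine ⟨LinearMap.linearEquivOfInjective Θ hinj hfr, fun v => ?_⟩
  rw [LinearMap.linearEquivOfInjective_apply, LinearMap.linearEquivOfInjective_apply, hΘ]
  exact hΘW (φ.rangeRestrict v)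

variable (φ) in
theorem map_subtype_iterateRange (k : ℕ) :
    (iterateRange (φ.rangeRestrict ∘ₛₗ (LinearMap.range φ).subtype) k).map
      (LinearMap.range φ).subtype = iterateRange φ (k + 1) := by
  set φ₁ := φ.rangeRestrict ∘ₛₗ (LinearMap.range φ).subtype
  have hit (u : LinearMap.range φ) : ((φ₁^[k] u : LinearMap.range φ) : V) = φ^[k] u := by
    induction k with
    | zero => rfl
    | succ k ih =>
      rw [Function.iterate_succ_apply', Function.iterate_succ_apply', ← ih]
      rfl
  ext v
  rw [Submodule.mem_map, mem_iterateRange]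
  constructor
  · rintro ⟨w, hw, rfl⟩
    obtain ⟨⟨_, u, rfl⟩, rfl⟩ := mem_iterateRange.1 hw
    exact ⟨u, (hit ⟨φ u, u, rfl⟩).symm⟩
  · rintro ⟨u, rfl⟩
    exact ⟨_, mem_iterateRange.2 ⟨φ.rangeRestrict u, rfl⟩, hit _⟩

variable (φ) in
theorem finrank_iterateRange_rangeRestrict (k : ℕ) :
    finrank F (iterateRange (φ.rangeRestrict ∘ₛₗ (LinearMap.range φ).subtype) k) =
      finrank F (iterateRange φ (k + 1)) := by
  rw [← map_subtype_iterateRange φ k]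
  exact (Submodule.equivMapOfInjective _ (Submodule.injective_subtype _) _).finrank_eq

variable (φ) in
theorem finrank_iterateRange_zero : finrank F (iterateRange φ 0) = finrank F V :=
  finrank_top F V

/-- A nilpotent Frobenius-semilinear endomorphism of a finite-dimensional space over a perfect
field is determined up to isomorphism by the dimensions of the images of its iterates. -/
theorem exists_intertwining_of_finrank_iterateRange_eq (n : ℕ) {V V' : Type*}
    [AddCommGroup V] [Module F V] [AddCommGroup V'] [Module F V']
    [FiniteDimensional F V] [FiniteDimensional F V']
    (φ : V →ₛₗ[frobenius F p] V) (φ' : V' →ₛₗ[frobenius F p] V')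
    (hfr : ∀ k, finrank F (iterateRange φ k) = finrank F (iterateRange φ' k))
    (hn : iterateRange φ n = ⊥) :
    ∃ e : V ≃ₗ[F] V', ∀ v, e (φ v) = φ' (e v) := by
  induction n generalizing V V' with
  | zero =>
    have hfr0 := hfr 0
    rw [finrank_iterateRange_zero, finrank_iterateRange_zero] at hfr0
    have hV : Subsingleton V := by
      rw [iterateRange, Function.iterate_zero_apply] at hn
      exact (Submodule.subsingleton_iff F).1 (subsingleton_of_bot_eq_top hn.symm)
    refine ⟨LinearEquiv.ofFinrankEq V V' hfr0, fun v => ?_⟩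
    have h0 := fun v : V => Subsingleton.elim v 0
    rw [h0 (φ v), h0 v, map_zero, map_zero]
  | succ n ih =>
    have hfr0 := hfr 0
    rw [finrank_iterateRange_zero, finrank_iterateRange_zero] at hfr0
    have hfr1 (k) : finrank F (iterateRange (φ.rangeRestrict ∘ₛₗ (LinearMap.range φ).subtype) k) =
        finrank F (iterateRange (φ'.rangeRestrict ∘ₛₗ (LinearMap.range φ').subtype) k) := by
      rw [finrank_iterateRange_rangeRestrict, finrank_iterateRange_rangeRestrict, hfr]
    obtain ⟨ψ, hψ⟩ := ih (φ.rangeRestrict ∘ₛₗ (LinearMap.range φ).subtype)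
      (φ'.rangeRestrict ∘ₛₗ (LinearMap.range φ').subtype) hfr1
      (by
        rw [← map_subtype_iterateRange φ n] at hn
        exact Submodule.map_injective_of_injective (Submodule.injective_subtype _)
          (hn.trans (Submodule.map_bot _).symm))
    exact exists_intertwining_extend hfr0 ψ fun w => congrArg Subtype.val (hψ w)

end Classification

/-! ### Abelian restricted Lie algebras and the conclusion -/

namespace RestrictedLieAlgebra

variable (F : Type*) (p : ℕ) (L : Type*) [Field F] [Fact p.Prime] [CharP F p]
  [LieRing L] [LieAlgebra F L] [RestrictedLieAlgebra F p L] [IsLieAbelian L]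

/-- The `p`-map of an abelian restricted Lie algebra is semilinear. -/
def abelianPMap : L →ₛₗ[frobenius F p] L where
  toFun := pMap F p
  map_add' x y := by
    rw [pMap_add_of_class_two p (fun _ _ _ => trivial_lie_zero ..), trivial_lie_zero, ite_self, add_zero]
  map_smul' := pMap_smul

/-- The restricted enveloping algebra of an abelian restricted Lie algebra is commutative. -/
noncomputable abbrev envCommRing : CommRing (RestrictedEnveloping F p L) :=
  { (inferInstance : Ring (RestrictedEnveloping F p L)) with mul_comm := env_mul_comm F p }

attribute [local instance] envCommRing

theorem isTruncEnveloping_envι :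
    IsTruncEnveloping (abelianPMap F p L) (envι F p : L →ₗ[F] RestrictedEnveloping F p L) where
  pow_eq := envι_pow F p
  adjoin_range := adjoin_range_envι F p L
  exists_lift s b := exists_envLift F p (truncι p b (abelianPMap F p L))
    (fun x y => by rw [trivial_lie_zero, map_zero, mul_comm, sub_self])
    (fun x => truncι_pow p b (abelianPMap F p L) x)

variable (H : Type*) [LieRing H] [LieAlgebra F H] [RestrictedLieAlgebra F p H] [IsLieAbelian H]

theorem nonempty_restrictedLieEquiv_of_abelian [PerfectField F] [FiniteDimensional F L]
    (hnil : IsPNilpotent F p L)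
    (e : RestrictedEnveloping F p L ≃ₐ[F] RestrictedEnveloping F p H) :
    Nonempty (RestrictedLieEquiv F p L H) := by
  have hL := isTruncEnveloping_envι F p L
  have hH := isTruncEnveloping_envι F p H
  have : FiniteDimensional F (RestrictedEnveloping F p L) := hL.finiteDimensional
  -- $H$ embeds in $u(H)\cong u(L)$, which is finite-dimensional.
  have : FiniteDimensional F H :=
    FiniteDimensional.of_injective (e.symm.toLinearMap ∘ₗ envι F p)
      (e.symm.injective.comp hH.injective)
  obtain ⟨n, hn⟩ := hnil
  have hbot : iterateRange (abelianPMap F p L) n = ⊥ := by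
    rw [eq_bot_iff]
    intro v hv
    obtain ⟨u, rfl⟩ := mem_iterateRange.1 hv
    exact hn u
  obtain ⟨f, hf⟩ := exists_intertwining_of_finrank_iterateRange_eq n (abelianPMap F p L)
    (abelianPMap F p H) (hL.finrank_iterateRange_eq hH e) hbot
  exact ⟨{ f with
    map_lie' := fun {x y} => by
      change f ⁅x, y⁆ = ⁅f x, f y⁆
      rw [trivial_lie_zero, trivial_lie_zero, map_zero]
    map_pMap := hf }⟩

end RestrictedLieAlgebra

theorem mainTheorem2 {F L H : Type*} (p : ℕ) [Fact p.Prime] [Field F] [CharP F p]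
    [PerfectField F]
    [LieRing L] [LieAlgebra F L] [RestrictedLieAlgebra F p L]
    [LieRing H] [LieAlgebra F H] [RestrictedLieAlgebra F p H]
    (hfin : FiniteDimensional F L) (hnil : RestrictedLieAlgebra.IsPNilpotent F p L)
    (hab : IsLieAbelian L)
    (hu : Nonempty (RestrictedLieAlgebra.RestrictedEnveloping F p L ≃ₐ[F]
      RestrictedLieAlgebra.RestrictedEnveloping F p H)) :
    Nonempty (RestrictedLieAlgebra.RestrictedLieEquiv F p L H) := by
  obtain ⟨e⟩ := hu
  have hc (a b : RestrictedLieAlgebra.RestrictedEnveloping F p H) : a * b = b * a := by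
    apply e.symm.injective
    rw [map_mul, map_mul, RestrictedLieAlgebra.env_mul_comm]
  have := RestrictedLieAlgebra.isLieAbelian_of_env_comm p hc
  exact RestrictedLieAlgebra.nonempty_restrictedLieEquiv_of_abelian F p L H hnil e
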